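/- A \emph{dimension function} is a (weakly) increasing, right-continuous function $h:[0,\infty)\to[0,\infty)$ with $h(0)=0$ and $h(t)>0$ for all $t>0$. For dimension functions $h_1,h_2$ write $h_2\prec h_1$ if $\lim_{x\to 0^+} h_1(x)/h_2(x)=0$. The Hausdorff measure associated with $h$ is $$\mathcal{H}^h(E)=\lim_{\delta\to 0^+}\inf\Big\{\sum_{i\in\mathbb{N}} h(|U_i|) : E\subseteq\bigcup_{i\in\mathbb{N}} U_i,\ |U_i|\le\delta \text{ for all } i\Big\},$$ where $|U|$ denotes the Euclidean diameter of $U$. \textbf{Theorem 1.} Let $d\ge 1$ be an integer, let $h$ be a dimension function with $h\prec x^d$, and let $(\psi_k)_{k\in\mathbb{N}}$ be a sequence of non-zero linear functions $\psi_k:(\mathbb{R}^d)^{m_k}\to\mathbb{R}$ with integers $m_k\ge 2$. Then there exists a compact set $E\subseteq\mathbb{R}^d$ such that $\mathcal{H}^h(E)>0$ and $\psi_k(x_1,\dots,x_{m_k})\ne 0$ for all $k\in\mathbb{N}$ and all distinct vectors $x_1,\dots,x_{m_k}\in E$. -/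

import Mathlib

open Filter MeasureTheory
open scoped NNReal ENNReal Topology

/-- A dimension function: `h : [0, ∞) → [0, ∞)` with `h 0 = 0` and `h t > 0` for `t > 0`,
(weakly) increasing and right-continuous. -/
structure IsDimensionFunction (h : ℝ≥0 → ℝ≥0) : Prop where
  map_zero : h 0 = 0
  pos : ∀ t, 0 < t → 0 < h t
  mono : Monotone h
  right_cont : ∀ t, ContinuousWithinAt h (Set.Ici t) t

/-- `DimPrec h₂ h₁` is the relation `h₂ ≺ h₁`, that is, `h₁ x / h₂ x → 0` as `x → 0⁺`. -/
def DimPrec (h₂ h₁ : ℝ≥0 → ℝ≥0) : Prop :=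
  Tendsto (fun x => h₁ x / h₂ x) (𝓝[>] 0) (𝓝 0)

/-- The Hausdorff measure associated with `h`: the limit as `δ → 0` of the infimum of
`∑ i, h (diam (U i))` over the countable coverings of the given set by sets of diameter at most `δ`
(see `MeasureTheory.Measure.mkMetric_apply`). The junk value of `ENNReal.toNNReal` at `∞` plays no
role, since only sets of diameter at most `δ < ∞` matter. -/
noncomputable def hausdorffMeasureOf {X : Type*} [MetricSpace X] [MeasurableSpace X] [BorelSpace X]
    (h : ℝ≥0 → ℝ≥0) : Measure X :=
  Measure.mkMetric fun r : ℝ≥0∞ => (h r.toNNReal : ℝ≥0∞)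

/-!
The set is `E = K ∩ ⋂ n, F n` for the closed unit ball `K` and closed sets `F n`, each of which
deals with one equation `ψ k x = 0` and one tuple of pairwise disjoint basic open sets `B i`, in
which the variables are to lie. There are countably many such requirements, and every solution in
distinct vectors is covered by one of them.

For a single requirement, write `ψ x = ∑ i, L i (x i)` and restrict each `x i ∈ B i` to the slabs
on which `N * L i (x i)` is close to an integer, except that for one index with `L i ≠ 0` it is
close to a half-integer. Then `N * ψ x` is not an integer, and `ψ x ≠ 0`
(`exists_avoiding_modification`).

To see that little is lost, the construction carries along a measure `μ`. Multiplying `μ` by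
densities which are bounded independently of `N` concentrates it on the slabs, and as `N → ∞` the
new measures converge to `μ` on every measurable set, by the Riemann–Lebesgue lemma
(`tendsto_withDensity_modulation`). Let `μ` satisfy `μ B < h r` for countably many test balls `B`,
finitely many for each dyadic scale `r`. As `h ≺ x ^ d`, the uniform density bound yields these
inequalities for the new measures at all small scales, and the setwise convergence yields the
finitely many others for large `N`; likewise the total mass stays above a fixed positive number
(`IsSpread.exists_of_tendsto`). Any set of small diameter that meets `K` is contained in a test ball of
comparable scale, so that `μ n U ≤ h r` whenever `U` has diameter at most `r`, uniformly in the stage `n`.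

Finally `le_hausdorffMeasureOf_inter_iInter` gives the lower bound for the Hausdorff measure of `E`.
-/

/-! ### Equidistribution of linear functionals modulo one -/

section Equidistribution

theorem integral_fourier_haarAddCircle (n : ℤ) :
    ∫ t, (fourier n : C(UnitAddCircle, ℂ)) t ∂AddCircle.haarAddCircle = if n = 0 then 1 else 0 := by
  have h := congrFun (fourierCoeff_fourier (T := 1) n) 0
  rw [fourierCoeff] at h
  simpa [Pi.single_apply, eq_comm] using h

theorem integrable_comp_dual_natCast_mul {V : Type*} [NormedAddCommGroup V] [NormedSpace ℝ V]
    [MeasurableSpace V] [BorelSpace V] (μ : Measure V) [IsFiniteMeasure μ] (L : StrongDual ℝ V)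
    (φ : C(UnitAddCircle, ℂ)) (N : ℕ) :
    Integrable (fun x => φ ((N * L x : ℝ) : UnitAddCircle)) μ := by
  have hc : Continuous fun x => φ ((N * L x : ℝ) : UnitAddCircle) :=
    φ.continuous.comp ((AddCircle.continuous_mk' 1).comp (by fun_prop))
  exact Integrable.of_bound hc.aestronglyMeasurable ‖φ‖ (ae_of_all _ fun x => φ.norm_coe_le_norm _)

variable {V : Type*} [NormedAddCommGroup V] [NormedSpace ℝ V] [FiniteDimensional ℝ V]
  [MeasurableSpace V] [BorelSpace V]

theorem tendsto_integral_fourier_comp_dual {ν μ : Measure V} [ν.IsAddHaarMeasure]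
    [IsFiniteMeasure μ] (hμ : μ ≪ ν) {L : StrongDual ℝ V} (hL : L ≠ 0) (n : ℤ) :
    Tendsto (fun N : ℕ => ∫ x, (fourier n : C(UnitAddCircle, ℂ)) ((N * L x : ℝ) : UnitAddCircle) ∂μ)
      atTop (𝓝 ((∫ t, (fourier n : C(UnitAddCircle, ℂ)) t ∂AddCircle.haarAddCircle)
        * μ.real Set.univ)) := by
  rw [integral_fourier_haarAddCircle]
  split_ifs with hn
  · subst hn
    simp
  · rw [zero_mul]
    have hw : Tendsto (fun N : ℕ => (-(n * N : ℝ)) • L) atTop (cocompact (StrongDual ℝ V)) := by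
      rw [← Metric.cobounded_eq_cocompact, ← tendsto_norm_atTop_iff_cobounded]
      have hn' : 0 < |(n : ℝ)| * ‖L‖ := by positivity
      have := (tendsto_natCast_atTop_atTop (R := ℝ)).const_mul_atTop hn'
      refine this.congr fun N => ?_
      rw [norm_smul, norm_neg, norm_mul, Real.norm_eq_abs, Real.norm_natCast]
      ring
    have := (tendsto_integral_exp_smul_cocompact
      (fun x => ((μ.rnDeriv ν x).toReal : ℂ)) ν).comp hw
    refine this.congr fun N => ?_
    rw [← integral_rnDeriv_smul hμ]
    refine integral_congr_ae (ae_of_all _ fun x => ?_)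
    simp only [Circle.smul_def, fourier_coe_apply, Real.fourierChar_apply]
    simp
    rw [mul_comm]
    congr 2
    ring

/-- Equidistribution: if `μ` is absolutely continuous with respect to Haar measure and `L` is a
non-zero functional, the images of `μ` under `x ↦ N * L x mod 1` converge to a multiple of Haar
measure on the circle. For characters this is the Riemann–Lebesgue lemma, and trigonometric
polynomials are uniformly dense. -/
theorem tendsto_integral_comp_dual_natCast_mul {ν μ : Measure V} [ν.IsAddHaarMeasure]
    [IsFiniteMeasure μ] (hμ : μ ≪ ν) {L : StrongDual ℝ V} (hL : L ≠ 0) (φ : C(UnitAddCircle, ℂ)) :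
    Tendsto (fun N : ℕ => ∫ x, φ ((N * L x : ℝ) : UnitAddCircle) ∂μ) atTop
      (𝓝 ((∫ t, φ t ∂AddCircle.haarAddCircle) * μ.real Set.univ)) := by
  have hint (φ : C(UnitAddCircle, ℂ)) : Integrable φ AddCircle.haarAddCircle :=
    Integrable.of_bound φ.continuous.aestronglyMeasurable ‖φ‖
      (ae_of_all _ fun x => φ.norm_coe_le_norm _)
  have hspan : ∀ φ ∈ Submodule.span ℂ (Set.range (fourier (T := 1))),
      Tendsto (fun N : ℕ => ∫ x, φ ((N * L x : ℝ) : UnitAddCircle) ∂μ) atTop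
      (𝓝 ((∫ t, φ t ∂AddCircle.haarAddCircle) * μ.real Set.univ)) := by
    intro φ hφ
    induction hφ using Submodule.span_induction with
    | mem φ h =>
      obtain ⟨n, rfl⟩ := h
      exact tendsto_integral_fourier_comp_dual hμ hL n
    | zero => simp
    | add φ φ' _ _ h h' =>
      simp only [ContinuousMap.add_apply]
      rw [integral_add (hint φ) (hint φ'), add_mul]
      refine (h.add h').congr fun N => ?_
      rw [integral_add (integrable_comp_dual_natCast_mul μ L φ N)
        (integrable_comp_dual_natCast_mul μ L φ' N)]
    | smul c φ _ h =>
      simp only [ContinuousMap.smul_apply, smul_eq_mul, integral_const_mul]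
      rw [mul_assoc]
      exact h.const_mul c
  have hφ : φ ∈ closure
      (Submodule.span ℂ (Set.range (fourier (T := 1))) : Set C(UnitAddCircle, ℂ)) := by
    rw [← Submodule.topologicalClosure_coe, span_fourier_closure_eq_top]
    trivial
  rw [Metric.tendsto_atTop]
  intro ε hε
  set M := μ.real Set.univ
  have hM : 0 ≤ M := measureReal_nonneg
  obtain ⟨φ', hφ', hd⟩ := Metric.mem_closure_iff.1 hφ (ε / (4 * (M + 1))) (by positivity)
  obtain ⟨N₀, hN₀⟩ := Metric.tendsto_atTop.1 (hspan φ' hφ') (ε / 2) (by positivity)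
  refine ⟨N₀, fun N hN => ?_⟩
  have h1 := hN₀ N hN
  rw [dist_eq_norm] at h1 hd ⊢
  have hsub : ‖φ - φ'‖ * M ≤ ε / 4 := by
    have : ‖φ - φ'‖ * (M + 1) ≤ ε / (4 * (M + 1)) * (M + 1) := by gcongr
    have h2 : ε / (4 * (M + 1)) * (M + 1) = ε / 4 := by field_simp
    nlinarith [norm_nonneg (φ - φ')]
  have h2 : ‖(∫ x, φ ((N * L x : ℝ) : UnitAddCircle) ∂μ)
      - ∫ x, φ' ((N * L x : ℝ) : UnitAddCircle) ∂μ‖ ≤ ‖φ - φ'‖ * M := by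
    rw [← integral_sub (integrable_comp_dual_natCast_mul μ L φ N)
      (integrable_comp_dual_natCast_mul μ L φ' N)]
    exact norm_integral_le_of_norm_le_const (ae_of_all _ fun x => (φ - φ').norm_coe_le_norm _)
  have h3 : ‖(∫ t, φ' t ∂AddCircle.haarAddCircle) * (M : ℂ)
      - (∫ t, φ t ∂AddCircle.haarAddCircle) * (M : ℂ)‖ ≤ ‖φ - φ'‖ * M := by
    rw [← sub_mul, ← integral_sub (hint φ') (hint φ), norm_mul, Complex.norm_real,
      Real.norm_of_nonneg hM, norm_sub_rev φ]
    gcongr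
    simpa using norm_integral_le_of_norm_le_const (μ := AddCircle.haarAddCircle)
      (ae_of_all _ fun x => (φ' - φ).norm_coe_le_norm x)
  have := norm_add₃_le (a := (∫ x, φ ((N * L x : ℝ) : UnitAddCircle) ∂μ)
      - ∫ x, φ' ((N * L x : ℝ) : UnitAddCircle) ∂μ)
    (b := (∫ x, φ' ((N * L x : ℝ) : UnitAddCircle) ∂μ)
      - (∫ t, φ' t ∂AddCircle.haarAddCircle) * (M : ℂ))
    (c := (∫ t, φ' t ∂AddCircle.haarAddCircle) * (M : ℂ)
      - (∫ t, φ t ∂AddCircle.haarAddCircle) * (M : ℂ))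
  rw [sub_add_sub_cancel, sub_add_sub_cancel] at this
  linarith

/-- Localised real form of the equidistribution theorem: test functions of integral one are
asymptotically invisible on every measurable set. -/
theorem tendsto_setIntegral_comp_dual_natCast_mul {ν μ : Measure V} [ν.IsAddHaarMeasure]
    [IsFiniteMeasure μ] (hμ : μ ≪ ν) {L : StrongDual ℝ V} (hL : L ≠ 0) (φ : C(UnitAddCircle, ℝ))
    (hφ : ∫ t, φ t ∂AddCircle.haarAddCircle = 1) (A : Set V) :
    Tendsto (fun N : ℕ => ∫ x in A, φ ((N * L x : ℝ) : UnitAddCircle) ∂μ) atTop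
      (𝓝 (μ.real A)) := by
  have h := tendsto_integral_comp_dual_natCast_mul (ν := ν) (μ := μ.restrict A)
    (Measure.absolutelyContinuous_of_le Measure.restrict_le_self |>.trans hμ) hL
    ⟨fun t => (φ t : ℂ), by fun_prop⟩
  have h' := (Complex.continuous_re.tendsto _).comp h
  simp only [ContinuousMap.coe_mk, integral_complex_ofReal, hφ, Complex.ofReal_one, one_mul,
    Complex.ofReal_re, Function.comp_def, measureReal_restrict_apply_univ] at h'
  exact h'

end Equidistribution

/-! ### Concentrating a measure on slabs -/

section Modulation

/-- A continuous bump of integral one on the circle, concentrated near `s`. -/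
theorem exists_bump_unitAddCircle (s : UnitAddCircle) {c : ℝ} (hc : 0 < c) :
    ∃ φ : C(UnitAddCircle, ℝ), (∀ t, 0 ≤ φ t) ∧ (∀ t, φ t ≠ 0 → ‖t - s‖ ≤ c) ∧
      ∫ t, φ t ∂AddCircle.haarAddCircle = 1 := by
  let f : C(UnitAddCircle, ℝ) := ⟨fun t => max 0 (c - ‖t - s‖), by fun_prop⟩
  have hf0 : ∀ t, 0 ≤ f t := fun t => le_max_left _ _
  have hpos : 0 < ∫ t, f t ∂AddCircle.haarAddCircle :=
    f.continuous.integral_pos_of_hasCompactSupport_nonneg_nonzero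
      (HasCompactSupport.of_compactSpace _) hf0 (x := s) (by simp [f, hc])
  refine ⟨(∫ t, f t ∂AddCircle.haarAddCircle)⁻¹ • f, fun t => ?_, fun t ht => ?_, ?_⟩
  · exact mul_nonneg (inv_nonneg.2 hpos.le) (hf0 t)
  · by_contra! hlt
    exact ht (by simp [f, hlt.le])
  · simp only [ContinuousMap.smul_apply, smul_eq_mul]
    rw [integral_const_mul, inv_mul_cancel₀ hpos.ne']

theorem continuous_comp_dual_natCast_mul {V X : Type*} [NormedAddCommGroup V] [NormedSpace ℝ V]
    [TopologicalSpace X] (L : StrongDual ℝ V)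
    {φ : UnitAddCircle → X} (hφ : Continuous φ) (N : ℕ) :
    Continuous fun x => φ ((N * L x : ℝ) : UnitAddCircle) :=
  hφ.comp ((AddCircle.continuous_mk' 1).comp (by fun_prop))

variable {V ι : Type*} [NormedAddCommGroup V] [NormedSpace ℝ V] [Fintype ι]

/-- The function equal to `φ j (N * L j x mod 1)` for `x` in `B j` and to `1` off `⋃ j, B j`,
when the sets `B j` are pairwise disjoint. It is written as a sum so that its integrals are
immediate. -/
noncomputable def modulation (B : ι → Set V) (L : ι → StrongDual ℝ V)
    (φ : ι → C(UnitAddCircle, ℝ)) (N : ℕ) (x : V) : ℝ :=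
  1 + ∑ j, (B j).indicator (fun x => φ j ((N * L j x : ℝ) : UnitAddCircle) - 1) x

section modulation

variable {B : ι → Set V} {L : ι → StrongDual ℝ V} {φ : ι → C(UnitAddCircle, ℝ)}

theorem modulation_of_mem (hB : Pairwise (Function.onFun Disjoint B)) (N : ℕ) {x : V} {j : ι}
    (hx : x ∈ B j) : modulation B L φ N x = φ j ((N * L j x : ℝ) : UnitAddCircle) := by
  rw [modulation, Finset.sum_eq_single j]
  · simp [hx]
  · intro k _ hk
    exact Set.indicator_of_notMem (fun h => (hB hk).le_bot ⟨h, hx⟩) _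
  · simp

theorem modulation_of_forall_notMem (N : ℕ) {x : V} (hx : ∀ j, x ∉ B j) :
    modulation B L φ N x = 1 := by
  simp [modulation, hx]

theorem modulation_nonneg (hB : Pairwise (Function.onFun Disjoint B)) (hφ : ∀ j t, 0 ≤ φ j t)
    (N : ℕ) (x : V) : 0 ≤ modulation B L φ N x := by
  by_cases hx : ∃ j, x ∈ B j
  · obtain ⟨j, hj⟩ := hx
    rw [modulation_of_mem hB N hj]
    exact hφ _ _
  · push Not at hx
    rw [modulation_of_forall_notMem N hx]
    exact zero_le_one

theorem modulation_le (hB : Pairwise (Function.onFun Disjoint B)) (N : ℕ) (x : V) :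
    modulation B L φ N x ≤ 1 + ∑ j, ‖φ j‖ := by
  by_cases hx : ∃ j, x ∈ B j
  · obtain ⟨j, hj⟩ := hx
    rw [modulation_of_mem hB N hj]
    have h1 := (φ j).apply_le_norm ((N * L j x : ℝ) : UnitAddCircle)
    have h2 := Finset.single_le_sum (f := fun j => ‖φ j‖) (fun _ _ => norm_nonneg _)
      (Finset.mem_univ j)
    linarith
  · push Not at hx
    rw [modulation_of_forall_notMem N hx]
    linarith [Finset.sum_nonneg (s := Finset.univ) fun j _ => norm_nonneg (φ j)]

variable [MeasurableSpace V] [BorelSpace V]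

theorem measurable_modulation (hBo : ∀ j, IsOpen (B j)) (N : ℕ) :
    Measurable (modulation B L φ N) := by
  refine measurable_const.add (Finset.measurable_fun_sum _ fun j _ => ?_)
  exact ((continuous_comp_dual_natCast_mul (L j) (φ j).continuous N).measurable.sub_const
    1).indicator (hBo j).measurableSet

variable [FiniteDimensional ℝ V]

/-- The modulated measures converge setwise to the original one: modulation at a high frequency
does not change the distribution of mass at a fixed scale. -/
theorem tendsto_withDensity_modulation {ν μ : Measure V} [ν.IsAddHaarMeasure]
    [IsFiniteMeasure μ] (hμ : μ ≪ ν) (hB : Pairwise (Function.onFun Disjoint B))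
    (hBo : ∀ j, IsOpen (B j)) (hφ : ∀ j t, 0 ≤ φ j t)
    (hφ1 : ∀ j, ∫ t, φ j t ∂AddCircle.haarAddCircle = 1) (hL : ∀ j, L j = 0 → φ j = 1)
    {A : Set V} (hA : MeasurableSet A) :
    Tendsto (fun N => μ.withDensity (fun x => ENNReal.ofReal (modulation B L φ N x)) A) atTop
      (𝓝 (μ A)) := by
  have hi (j : ι) (N : ℕ) :
      Integrable (fun x => φ j ((N * L j x : ℝ) : UnitAddCircle) - 1) (μ.restrict A) := by
    refine Integrable.sub ?_ (integrable_const _)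
    exact Integrable.of_bound
      (continuous_comp_dual_natCast_mul (L j) (φ j).continuous N).aestronglyMeasurable
      ‖φ j‖ (ae_of_all _ fun x => (φ j).norm_coe_le_norm _)
  have hj (j : ι) : Tendsto (fun N : ℕ =>
      ∫ x in A, (B j).indicator (fun x => φ j ((N * L j x : ℝ) : UnitAddCircle) - 1) x ∂μ)
      atTop (𝓝 0) := by
    by_cases h0 : L j = 0
    · simp [hL j h0]
    have := (tendsto_setIntegral_comp_dual_natCast_mul hμ h0 (φ j) (hφ1 j) (B j ∩ A)).sub_const
      (μ.real (B j ∩ A))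
    rw [sub_self] at this
    refine this.congr fun N => ?_
    rw [integral_indicator (hBo j).measurableSet, Measure.restrict_restrict (hBo j).measurableSet,
      integral_sub _ (integrable_const _)]
    · simp
    · exact Integrable.of_bound
        (continuous_comp_dual_natCast_mul (L j) (φ j).continuous N).aestronglyMeasurable
        ‖φ j‖ (ae_of_all _ fun x => (φ j).norm_coe_le_norm _)
  have hint : Tendsto (fun N => ∫ x in A, modulation B L φ N x ∂μ) atTop (𝓝 (μ.real A)) := by
    have := (tendsto_finsetSum Finset.univ fun j _ => hj j).const_add (μ.real A)
    rw [Finset.sum_const_zero, add_zero] at this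
    refine this.congr fun N => ?_
    simp only [modulation]
    rw [integral_add (integrable_const _)
      (integrable_finsetSum _ fun j _ => (hi j N).indicator (hBo j).measurableSet),
      integral_finsetSum _ fun j _ => (hi j N).indicator (hBo j).measurableSet]
    simp
  have := ENNReal.tendsto_ofReal hint
  rw [ofReal_measureReal] at this
  refine this.congr fun N => ?_
  rw [withDensity_apply _ hA, ofReal_integral_eq_lintegral_ofReal _
    (ae_of_all _ fun x => modulation_nonneg hB hφ N x)]
  refine Integrable.of_bound (measurable_modulation hBo N).aestronglyMeasurable
    (1 + ∑ j, ‖φ j‖) (ae_of_all _ fun x => ?_)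
  rw [Real.norm_of_nonneg (modulation_nonneg hB hφ N x)]
  exact modulation_le hB N x

end modulation

/-- The key step. A measure can be modified by a bounded density, with an arbitrarily small
effect on any given set, so as to live on a closed set `F` on which the equation `ψ x = 0` has no
solution with `x i ∈ B i`. For `x i ∈ F ∩ B i` the numbers `N * ψ (Pi.single i (x i))` are within
`c` of integers, except for one `i`, where this number is within `c` of a half-integer; so
`N * ψ x` is not an integer. -/
theorem exists_avoiding_modification [MeasurableSpace V] [BorelSpace V] [FiniteDimensional ℝ V]
    [DecidableEq ι] {ψ : (ι → V) →ₗ[ℝ] ℝ} (hψ : ψ ≠ 0) {B : ι → Set V} (hBo : ∀ j, IsOpen (B j))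
    (hB : Pairwise (Function.onFun Disjoint B)) {ν : Measure V} [ν.IsAddHaarMeasure]
    (μ : Measure V) [IsFiniteMeasure μ] (hμ : μ ≪ ν) :
    ∃ (C : ℝ≥0) (μ' : ℕ → Measure V) (F : ℕ → Set V), (∀ N, IsClosed (F N)) ∧
      (∀ N, ∀ x : ι → V, (∀ i, x i ∈ F N ∩ B i) → ψ x ≠ 0) ∧ (∀ N, μ' N (F N)ᶜ = 0) ∧
      (∀ N, μ' N ≤ C • μ) ∧
      ∀ A, MeasurableSet A → Tendsto (fun N => μ' N A) atTop (𝓝 (μ A)) := by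
  let L : ι → StrongDual ℝ V := fun j =>
    LinearMap.toContinuousLinearMap (ψ ∘ₗ LinearMap.single ℝ (fun _ => V) j)
  have hψL (x : ι → V) : ψ x = ∑ j, L j (x j) := by
    simp [L, ← map_sum, Finset.univ_sum_single]
  obtain ⟨i₀, hi₀⟩ : ∃ i, L i ≠ 0 := by
    by_contra! h
    exact hψ (LinearMap.ext fun x => by simp [hψL, h])
  let s : ι → UnitAddCircle := fun j => if j = i₀ then ((1 / 2 : ℝ) : UnitAddCircle) else 0
  -- The deviations of all terms from their targets add up to at most `card ι * c < 1 / 2`.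
  let c : ℝ := 1 / (2 * (Fintype.card ι + 1))
  have hc : 0 < c := by positivity
  -- No modulation is applied where `L j = 0`, since high frequencies cause no oscillation there.
  have hbump (j : ι) : ∃ φ : C(UnitAddCircle, ℝ), (∀ t, 0 ≤ φ t) ∧
      (L j ≠ 0 → ∀ t, φ t ≠ 0 → ‖t - s j‖ ≤ c) ∧
      ∫ t, φ t ∂AddCircle.haarAddCircle = 1 ∧ (L j = 0 → φ = 1) := by
    by_cases h0 : L j = 0
    · exact ⟨1, by simp, by simp [h0], by simp, fun _ => rfl⟩
    · obtain ⟨φ, h1, h2, h3⟩ := exists_bump_unitAddCircle (s j) hc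
      exact ⟨φ, h1, fun _ => h2, h3, fun h => absurd h h0⟩
  choose φ hφ0 hφs hφ1 hφL using hbump
  let S : ℕ → ι → Set V := fun N j => {x | ‖((N * L j x : ℝ) : UnitAddCircle) - s j‖ ≤ c}
  have hS (N : ℕ) (j : ι) (x : V)
      (hx : L j ≠ 0 → φ j ((N * L j x : ℝ) : UnitAddCircle) ≠ 0) : x ∈ S N j := by
    by_cases h0 : L j = 0
    · have : j ≠ i₀ := fun h => hi₀ (h ▸ h0)
      simp [S, h0, s, this, hc.le]
    · exact hφs j h0 _ (hx h0)
  refine ⟨Real.toNNReal (1 + ∑ j, ‖φ j‖),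
    fun N => μ.withDensity (fun x => ENNReal.ofReal (modulation B L φ N x)),
    fun N => ⋂ j, (B j)ᶜ ∪ S N j, fun N => ?_, fun N x hx h0 => ?_, fun N => ?_, fun N => ?_,
    fun A hA => tendsto_withDensity_modulation hμ hB hBo hφ0 hφ1 hφL hA⟩
  · refine isClosed_iInter fun j => (hBo j).isClosed_compl.union ?_
    exact isClosed_le (continuous_comp_dual_natCast_mul (L j)
      (φ := fun t => ‖t - s j‖) (by fun_prop) N) continuous_const
  · have hx' (j : ι) : ‖((N * L j (x j) : ℝ) : UnitAddCircle) - s j‖ ≤ c :=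
      (Set.mem_iInter.1 (hx j).1 j).resolve_left fun h => h (hx j).2
    have hsum : ∑ j, (((N * L j (x j) : ℝ) : UnitAddCircle) - s j)
        = -((1 / 2 : ℝ) : UnitAddCircle) := by
      have h1 : ∑ j, ((N * L j (x j) : ℝ) : UnitAddCircle) = 0 := by
        have : ((∑ j, (N * L j (x j)) : ℝ) : UnitAddCircle)
            = ∑ j, ((N * L j (x j) : ℝ) : UnitAddCircle) :=
          map_sum (QuotientAddGroup.mk' (AddSubgroup.zmultiples (1 : ℝ))) _ _
        rw [← this, ← Finset.mul_sum, ← hψL, h0]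
        simp
      rw [Finset.sum_sub_distrib, h1]
      simp [s]
    have hnorm : ‖((1 / 2 : ℝ) : UnitAddCircle)‖ = 1 / 2 := by
      simpa using AddCircle.norm_half_period_eq (p := (1 : ℝ))
    have h2 : (1 / 2 : ℝ) ≤ Fintype.card ι * c := by
      calc (1 / 2 : ℝ) = ‖∑ j, (((N * L j (x j) : ℝ) : UnitAddCircle) - s j)‖ := by
            rw [hsum, norm_neg, hnorm]
        _ ≤ ∑ _j : ι, c := norm_sum_le_of_le _ fun j _ => hx' j
        _ = Fintype.card ι * c := by simp
    have h3 : Fintype.card ι * c < 1 / 2 := by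
      simp only [c]
      rw [mul_one_div, div_lt_div_iff₀ (by positivity) (by norm_num)]
      linarith
    linarith
  · rw [Set.compl_iInter, measure_iUnion_null_iff]
    intro j
    rw [withDensity_apply_eq_zero (measurable_modulation hBo N).ennreal_ofReal]
    convert measure_empty (μ := μ)
    rw [Set.eq_empty_iff_forall_notMem]
    rintro x ⟨hx1, hx2⟩
    rw [Set.compl_union, compl_compl] at hx2
    refine hx2.2 (hS N j x fun _ h => hx1 ?_)
    rw [modulation_of_mem hB N hx2.1, h, ENNReal.ofReal_zero]
  · calc μ.withDensity (fun x => ENNReal.ofReal (modulation B L φ N x))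
        ≤ μ.withDensity (fun _ => ENNReal.ofReal (1 + ∑ j, ‖φ j‖)) :=
          withDensity_mono (ae_of_all _ fun x => ENNReal.ofReal_le_ofReal (modulation_le hB N x))
      _ = _ := by rw [withDensity_const]; rfl

end Modulation

/-! ### The mass distribution principle -/

theorem IsDimensionFunction.exists_add_two_mul_le {h : ℝ≥0 → ℝ≥0} (hh : IsDimensionFunction h)
    (a : ℝ≥0) {ε δ : ℝ≥0} (hε : 0 < ε) (hδ : 0 < δ) :
    ∃ η, 0 < η ∧ η ≤ δ ∧ h (a + 2 * η) ≤ h a + ε := by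
  have h1 : Tendsto (fun η : ℝ≥0 => a + 2 * η) (𝓝[>] 0) (𝓝[≥] a) := by
    refine tendsto_nhdsWithin_iff.2 ⟨?_, Eventually.of_forall fun η => Set.mem_Ici.2 le_self_add⟩
    have : Continuous fun η : ℝ≥0 => a + 2 * η := by fun_prop
    simpa using (this.tendsto 0).mono_left nhdsWithin_le_nhds
  have h2 := ((hh.right_cont a).tendsto.comp h1).eventually
    (gt_mem_nhds (lt_add_of_pos_right (h a) hε))
  have h3 : ∀ᶠ η : ℝ≥0 in 𝓝[>] 0, η ≤ δ :=
    nhdsWithin_le_nhds (eventually_le_nhds hδ)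
  obtain ⟨η, ⟨hη1, hη2⟩, hη3⟩ := ((h2.and h3).and self_mem_nhdsWithin).exists
  exact ⟨η, hη3, hη2, le_of_lt hη1⟩

/-- A mass distribution principle for a nested intersection of closed sets. It requires one measure
for each finite stage and no limit measure: by right-continuity of `h` the sets of a cover may be
replaced by open ones, which cover a finite stage by compactness. -/
theorem le_hausdorffMeasureOf_inter_iInter {X : Type*} [MetricSpace X] [MeasurableSpace X]
    [BorelSpace X] {h : ℝ≥0 → ℝ≥0} (hh : IsDimensionFunction h) {K : Set X} (hK : IsCompact K)
    {F : ℕ → Set X} (hF : ∀ n, IsClosed (F n)) {μ : ℕ → Measure X} (hμK : ∀ n, μ n Kᶜ = 0)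
    (hμF : ∀ n k, k < n → μ n (F k)ᶜ = 0) {c : ℝ≥0∞} (hc : ∀ n, c ≤ μ n Set.univ)
    {r₀ : ℝ≥0} (hr₀ : 0 < r₀)
    (hμ : ∀ n U, ∀ r : ℝ≥0, 0 < r → r ≤ r₀ → Metric.ediam U ≤ r → μ n U ≤ h r) :
    c ≤ hausdorffMeasureOf h (K ∩ ⋂ n, F n) := by
  rw [hausdorffMeasureOf, Measure.mkMetric_apply]
  refine le_iSup₂_of_le ((r₀ / 2 : ℝ≥0) : ℝ≥0∞) (by positivity) ?_
  refine le_iInf fun t => le_iInf fun ht => le_iInf fun hd => ?_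
  refine ENNReal.le_of_forall_pos_le_add fun ε hε _ => ?_
  obtain ⟨e, he0, he⟩ := ENNReal.exists_pos_sum_of_countable (ε := ε) (by positivity) ℕ
  have hη (i : ℕ) := hh.exists_add_two_mul_le (Metric.ediam (t i)).toNNReal (he0 i)
    (δ := r₀ / 4) (by positivity)
  choose η hη0 hηr hηh using hη
  let W : ℕ → Set X := fun i => Metric.thickening (η i) (t i)
  have hW : K ∩ ⋂ n, F n ⊆ ⋃ i, W i := ht.trans (Set.iUnion_mono fun i =>
    Metric.self_subset_thickening (by exact_mod_cast hη0 i) _)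
  have hWo : IsOpen (⋃ i, W i) := isOpen_iUnion fun i => Metric.isOpen_thickening
  obtain ⟨u, hu⟩ := (hK.diff hWo).elim_finite_subfamily_closed F hF (by
    rw [Set.eq_empty_iff_forall_notMem]
    rintro x ⟨⟨hxK, hxW⟩, hxF⟩
    exact hxW (hW ⟨hxK, hxF⟩))
  obtain ⟨n, hn⟩ : ∃ n, ∀ k ∈ u, k < n :=
    ⟨u.sup id + 1, fun k hk => Nat.lt_succ_of_le (Finset.le_sup (f := id) hk)⟩
  have hcompl : μ n (⋃ i, W i)ᶜ = 0 := by
    refine measure_mono_null (t := Kᶜ ∪ ⋃ k ∈ u, (F k)ᶜ) (fun x hx => ?_) ?_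
    · by_contra hx'
      simp only [Set.mem_union, Set.mem_compl_iff, Set.mem_iUnion, not_or, not_not,
        not_exists] at hx'
      have : x ∈ (K \ ⋃ i, W i) ∩ ⋂ k ∈ u, F k :=
        ⟨⟨hx'.1, hx⟩, Set.mem_iInter₂.2 fun k hk => hx'.2 k hk⟩
      rw [hu] at this
      exact this
    · refine measure_union_null (hμK n) ?_
      exact (measure_biUnion_null_iff u.countable_toSet).2 fun k hk => hμF n k (hn k hk)
  have hWi (i : ℕ) : μ n (W i) ≤
      (⨆ _ : (t i).Nonempty, (h (Metric.ediam (t i)).toNNReal : ℝ≥0∞)) + e i := by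
    rcases (t i).eq_empty_or_nonempty with hi | hi
    · simp [W, hi]
    · rw [iSup_pos hi]
      have hfin : Metric.ediam (t i) ≠ ∞ := ne_top_of_le_ne_top ENNReal.coe_ne_top (hd i)
      have ha : ((Metric.ediam (t i)).toNNReal : ℝ≥0∞) = Metric.ediam (t i) :=
        ENNReal.coe_toNNReal hfin
      have hle : (Metric.ediam (t i)).toNNReal + 2 * η i ≤ r₀ := by
        have h1 : (Metric.ediam (t i)).toNNReal ≤ r₀ / 2 := by
          rw [← ENNReal.coe_le_coe, ha]
          exact hd i
        calc _ ≤ r₀ / 2 + 2 * (r₀ / 4) := by gcongr; exact hηr i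
          _ = r₀ := by
            rw [← NNReal.coe_inj]
            push_cast
            ring
      refine (hμ n (W i) ((Metric.ediam (t i)).toNNReal + 2 * η i)
        (by have := hη0 i; positivity) hle ?_).trans ?_
      · push_cast
        rw [ha]
        exact Metric.ediam_thickening_le (η i)
      · exact_mod_cast hηh i
  calc c ≤ μ n Set.univ := hc n
    _ ≤ μ n (⋃ i, W i) + μ n (⋃ i, W i)ᶜ := by
        rw [← Set.union_compl_self (⋃ i, W i)]
        exact measure_union_le _ _
    _ ≤ ∑' i, μ n (W i) := by
        rw [hcompl, add_zero]
        exact measure_iUnion_le _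
    _ ≤ ∑' i, ((⨆ _ : (t i).Nonempty, (h (Metric.ediam (t i)).toNNReal : ℝ≥0∞)) + e i) :=
        ENNReal.tsum_le_tsum hWi
    _ ≤ _ := by
        rw [ENNReal.tsum_add]
        gcongr

/-! ### Measures controlled by a dimension function -/

/-- The dyadic scales `2⁻¹, 2⁻², …`. -/
noncomputable def dyadicScale (j : ℕ) : ℝ≥0 := (1 / 2) ^ (j + 1)

theorem dyadicScale_pos (j : ℕ) : 0 < dyadicScale j := by
  unfold dyadicScale
  positivity

theorem tendsto_dyadicScale : Tendsto dyadicScale atTop (𝓝[>] 0) := by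
  refine tendsto_nhdsWithin_iff.2 ⟨?_, Eventually.of_forall dyadicScale_pos⟩
  have : (1 / 2 : ℝ≥0) < 1 := by
    rw [← NNReal.coe_lt_coe]
    norm_num
  exact (NNReal.tendsto_pow_atTop_nhds_zero_of_lt_one this).comp (tendsto_add_atTop_nat 1)

/-- Since `h ≺ x ^ d`, every multiple of Lebesgue measure gives mass less than `h r` to the balls
of radius `4 * r`, for all small `r`. -/
theorem eventually_smul_volume_closedBall_lt {d : ℕ} {h : ℝ≥0 → ℝ≥0}
    (hh : IsDimensionFunction h) (hprec : DimPrec h (fun x => x ^ d)) (C : ℝ≥0) :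
    ∀ᶠ j in atTop, ∀ z : EuclideanSpace ℝ (Fin d),
      (C • volume) (Metric.closedBall z (4 * dyadicScale j)) < h (dyadicScale j) := by
  let ω : ℝ≥0 := (volume (Metric.ball (0 : EuclideanSpace ℝ (Fin d)) 1)).toNNReal
  have hω : (ω : ℝ≥0∞) = volume (Metric.ball (0 : EuclideanSpace ℝ (Fin d)) 1) :=
    ENNReal.coe_toNNReal measure_ball_lt_top.ne
  have hev := (hprec.comp tendsto_dyadicScale).eventually
    (gt_mem_nhds (show (0 : ℝ≥0) < 1 / (C * 4 ^ d * ω + 1) by positivity))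
  filter_upwards [hev] with j hj z
  have hpos := hh.pos _ (dyadicScale_pos j)
  have hx := dyadicScale_pos j
  have hvol : (C • volume) (Metric.closedBall z (4 * dyadicScale j))
      = ((C * 4 ^ d * ω * dyadicScale j ^ d : ℝ≥0) : ℝ≥0∞) := by
    rw [Measure.smul_apply, Measure.addHaar_closedBall _ _ (by positivity), ← hω]
    have : ENNReal.ofReal ((4 * (dyadicScale j : ℝ)) ^ Module.finrank ℝ (EuclideanSpace ℝ (Fin d)))
        = (((4 * dyadicScale j) ^ d : ℝ≥0) : ℝ≥0∞) := by
      rw [finrank_euclideanSpace_fin, ← ENNReal.ofReal_coe_nnreal]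
      push_cast
      rfl
    rw [this, ENNReal.smul_def, smul_eq_mul, ← ENNReal.coe_mul, ← ENNReal.coe_mul]
    congr 1
    ring
  rw [hvol, ENNReal.coe_lt_coe]
  simp only [Function.comp_apply] at hj
  rw [div_lt_div_iff₀ hpos (by positivity), one_mul] at hj
  refine lt_of_le_of_lt ?_ hj
  rw [mul_comm (dyadicScale j ^ d)]
  gcongr
  exact le_self_add

/-- The property of a measure that is preserved by the construction: it has a bounded density and
lives on `K`, its total mass exceeds `c`, and its mass on the balls of radius `4 * dyadicScale j`
centred at the points of the finite set `Z j` is controlled by `h`, for `j ≥ J`. The inequalities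
are strict so that they survive small perturbations. -/
structure IsSpread {d : ℕ} (h : ℝ≥0 → ℝ≥0) (K : Set (EuclideanSpace ℝ (Fin d)))
    (Z : ℕ → Set (EuclideanSpace ℝ (Fin d))) (J : ℕ) (c : ℝ≥0∞)
    (μ : Measure (EuclideanSpace ℝ (Fin d))) : Prop where
  exists_le : ∃ C : ℝ≥0, μ ≤ C • volume.restrict K
  lt_univ : c < μ Set.univ
  closedBall_lt : ∀ j, J ≤ j → ∀ z ∈ Z j,
    μ (Metric.closedBall z (4 * dyadicScale j)) < h (dyadicScale j)

namespace IsSpread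

variable {d : ℕ} {h : ℝ≥0 → ℝ≥0} {K : Set (EuclideanSpace ℝ (Fin d))}
  {Z : ℕ → Set (EuclideanSpace ℝ (Fin d))} {J : ℕ} {c : ℝ≥0∞}
  {μ : Measure (EuclideanSpace ℝ (Fin d))}

theorem absolutelyContinuous (hμ : IsSpread h K Z J c μ) : μ ≪ volume := by
  obtain ⟨C, hC⟩ := hμ.exists_le
  exact (Measure.absolutelyContinuous_of_le hC).trans ((Measure.AbsolutelyContinuous.rfl.smul_left
    C).trans (Measure.absolutelyContinuous_of_le Measure.restrict_le_self))

theorem isFiniteMeasure (hμ : IsSpread h K Z J c μ) (hK : IsCompact K) : IsFiniteMeasure μ := by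
  obtain ⟨C, hC⟩ := hμ.exists_le
  have : IsFiniteMeasure ((volume : Measure (EuclideanSpace ℝ (Fin d))).restrict K) :=
    ⟨by simpa using hK.measure_lt_top⟩
  exact isFiniteMeasure_of_le _ hC

theorem measure_compl (hμ : IsSpread h K Z J c μ) (hK : MeasurableSet K) : μ Kᶜ = 0 := by
  obtain ⟨C, hC⟩ := hμ.exists_le
  refine le_antisymm ((hC _).trans ?_) zero_le
  simp [Measure.restrict_apply hK.compl]

/-- A set of diameter at most `r` which meets `K` is contained in one of the controlled balls, if
the sets `Z j` are `2 * dyadicScale j`-nets of `K`. -/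
theorem measure_le (hμ : IsSpread h K Z J c μ) (hh : IsDimensionFunction h) (hK : MeasurableSet K)
    (hZ : ∀ j, K ⊆ ⋃ z ∈ Z j, Metric.ball z (2 * dyadicScale j))
    {U : Set (EuclideanSpace ℝ (Fin d))} {r : ℝ≥0} (hr : 0 < r) (hrJ : r ≤ dyadicScale J)
    (hU : Metric.ediam U ≤ r) : μ U ≤ h r := by
  have hhalf : (1 / 2 : ℝ≥0) < 1 := by
    rw [← NNReal.coe_lt_coe]
    norm_num
  obtain ⟨j, hj1, hj2⟩ := exists_nat_pow_near_of_lt_one hr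
    (hrJ.trans (pow_le_one₀ zero_le hhalf.le)) (by positivity) hhalf
  have hJj : J ≤ j := by
    have := (pow_lt_pow_iff_right_of_lt_one₀ (by positivity) hhalf).1 (hj1.trans_le hrJ)
    omega
  by_cases hUK : (U ∩ K).Nonempty
  · obtain ⟨y, hyU, hyK⟩ := hUK
    obtain ⟨z, hz, hyz⟩ := Set.mem_iUnion₂.1 (hZ j hyK)
    have hsub : U ⊆ Metric.closedBall z (4 * dyadicScale j) := by
      intro u hu
      have h1 : dist u y ≤ r := by
        have := (Metric.edist_le_ediam_of_mem hu hyU).trans hU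
        rw [edist_nndist, ENNReal.coe_le_coe] at this
        exact_mod_cast this
      have h2 : (r : ℝ) ≤ 2 * dyadicScale j := by
        have : (r : ℝ) ≤ (1 / 2) ^ j := by exact_mod_cast hj2
        rw [dyadicScale]
        push_cast
        rw [pow_succ]
        linarith
      rw [Metric.mem_closedBall]
      rw [Metric.mem_ball] at hyz
      linarith [dist_triangle u y z]
    calc μ U ≤ h (dyadicScale j) := (measure_mono hsub).trans (hμ.closedBall_lt j hJj z hz).le
      _ ≤ h r := by exact_mod_cast hh.mono hj1.le
  · have : U ⊆ Kᶜ := fun u hu huK => hUK ⟨u, hu, huK⟩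
    rw [measure_mono_null this (hμ.measure_compl hK)]
    exact zero_le

/-- Setwise convergence, together with a uniform bound on the densities, preserves the property:
the bound takes care of all small balls, and only finitely many balls remain. -/
theorem exists_of_tendsto (hμ : IsSpread h K Z J c μ) (hh : IsDimensionFunction h)
    (hprec : DimPrec h (fun x => x ^ d)) (hZ : ∀ j, (Z j).Finite) {C : ℝ≥0}
    {μ' : ℕ → Measure (EuclideanSpace ℝ (Fin d))} (hC : ∀ N, μ' N ≤ C • μ)
    (hlim : ∀ A, MeasurableSet A → Tendsto (fun N => μ' N A) atTop (𝓝 (μ A))) :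
    ∃ N, IsSpread h K Z J c (μ' N) := by
  obtain ⟨D, hD⟩ := hμ.exists_le
  have hle (N : ℕ) : μ' N ≤ (C * D) • volume.restrict K := by
    rw [mul_smul]
    refine (hC N).trans (Measure.le_iff'.2 fun s => ?_)
    rw [Measure.smul_apply, Measure.smul_apply]
    exact smul_le_smul_of_nonneg_left (hD s) zero_le
  obtain ⟨j₀, hj₀⟩ := eventually_atTop.1
    (eventually_smul_volume_closedBall_lt hh hprec (C * D))
  have h1 : ∀ᶠ N in atTop, c < μ' N Set.univ :=
    (hlim _ MeasurableSet.univ).eventually (lt_mem_nhds hμ.lt_univ)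
  have h2 : ∀ᶠ N in atTop, ∀ j ∈ Set.Ico J j₀, ∀ z ∈ Z j,
      μ' N (Metric.closedBall z (4 * dyadicScale j)) < h (dyadicScale j) := by
    refine (eventually_all_finite (Set.finite_Ico J j₀)).2 fun j hj => ?_
    refine (eventually_all_finite (hZ j)).2 fun z hz => ?_
    exact (hlim _ measurableSet_closedBall).eventually
      (gt_mem_nhds (hμ.closedBall_lt j hj.1 z hz))
  obtain ⟨N, hN1, hN2⟩ := (h1.and h2).exists
  refine ⟨N, ⟨⟨C * D, hle N⟩, hN1, fun j hj z hz => ?_⟩⟩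
  rcases lt_or_ge j j₀ with hlt | hge
  · exact hN2 j ⟨hj, hlt⟩ z hz
  · refine lt_of_le_of_lt ((hle N _).trans ?_) (hj₀ j hge z)
    rw [Measure.smul_apply, Measure.smul_apply]
    exact smul_le_smul_of_nonneg_left (Measure.restrict_apply_le _ _) zero_le

end IsSpread

theorem exists_isSpread_restrict {d : ℕ} {h : ℝ≥0 → ℝ≥0}
    (hh : IsDimensionFunction h) (hprec : DimPrec h (fun x => x ^ d))
    {K : Set (EuclideanSpace ℝ (Fin d))} (Z : ℕ → Set (EuclideanSpace ℝ (Fin d))) {c : ℝ≥0∞}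
    (hc : c < volume K) : ∃ J, IsSpread h K Z J c (volume.restrict K) := by
  obtain ⟨J, hJ⟩ := eventually_atTop.1 (eventually_smul_volume_closedBall_lt hh hprec 1)
  refine ⟨J, ⟨1, by rw [one_smul]⟩, by simpa using hc, fun j hj z _ => ?_⟩
  have := hJ j hj z
  rw [one_smul] at this
  exact (Measure.restrict_apply_le _ _).trans_lt this

/-! ### The construction -/

theorem exists_disjoint_mem_countableBasis {X ι : Type*} [TopologicalSpace X] [T2Space X]
    [SecondCountableTopology X] [Finite ι] {x : ι → X} (hx : Function.Injective x) :
    ∃ B : ι → TopologicalSpace.countableBasis X, (∀ i, x i ∈ (B i : Set X)) ∧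
      Pairwise (Function.onFun Disjoint fun i => (B i : Set X)) := by
  obtain ⟨U, hU, hdis⟩ := (Set.finite_range x).t2_separation
  have hB (i : ι) := (TopologicalSpace.isBasis_countableBasis X).exists_subset_of_mem_open
    (hU (x i)).1 (hU (x i)).2
  choose B hB hxB hBU using hB
  refine ⟨fun i => ⟨B i, hB i⟩, hxB, fun i j hij => ?_⟩
  exact (hdis ⟨i, rfl⟩ ⟨j, rfl⟩ (hx.ne hij)).mono (hBU i) (hBU j)

theorem theorem1 (d : ℕ) (hd : 1 ≤ d) (h : ℝ≥0 → ℝ≥0) (hh : IsDimensionFunction h)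
    (hprec : DimPrec h (fun x => x ^ d))
    (m : ℕ → ℕ) (hm : ∀ k, 2 ≤ m k)
    (ψ : (k : ℕ) → (Fin (m k) → EuclideanSpace ℝ (Fin d)) →ₗ[ℝ] ℝ) (hψ : ∀ k, ψ k ≠ 0) :
    ∃ E : Set (EuclideanSpace ℝ (Fin d)), IsCompact E ∧ 0 < hausdorffMeasureOf h E ∧
      ∀ k, ∀ x : Fin (m k) → EuclideanSpace ℝ (Fin d),
        (∀ i, x i ∈ E) → Function.Injective x → ψ k x ≠ 0 := by
  let K : Set (EuclideanSpace ℝ (Fin d)) := Metric.closedBall 0 1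
  have hK : IsCompact K := isCompact_closedBall 0 1
  have hKpos : volume K ≠ 0 := (Metric.measure_closedBall_pos volume 0 one_pos).ne'
  have hnet (j : ℕ) := hK.finite_cover_balls (e := 2 * dyadicScale j)
    (by have := dyadicScale_pos j; positivity)
  choose Z _ hZfin hZ using hnet
  obtain ⟨J, hJ⟩ := exists_isSpread_restrict hh hprec Z
    (ENNReal.half_lt_self hKpos hK.measure_ne_top)
  set c := volume K / 2
  -- Each requirement is an equation together with a choice of basic open sets for its variables.
  let R := Σ k, Fin (m k) → TopologicalSpace.countableBasis (EuclideanSpace ℝ (Fin d))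
  let S := {μ : Measure (EuclideanSpace ℝ (Fin d)) // IsSpread h K Z J c μ}
  have hstep (r : R) (μ : S) : ∃ (μ' : S) (F : Set (EuclideanSpace ℝ (Fin d))), IsClosed F ∧
      μ'.1 Fᶜ = 0 ∧ μ'.1 ≪ μ.1 ∧
      (Pairwise (Function.onFun Disjoint fun i => (r.2 i : Set (EuclideanSpace ℝ (Fin d)))) →
        ∀ x, (∀ i, x i ∈ F ∩ r.2 i) → ψ r.1 x ≠ 0) := by
    by_cases hB : Pairwise
        (Function.onFun Disjoint fun i => (r.2 i : Set (EuclideanSpace ℝ (Fin d))))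
    · have := μ.2.isFiniteMeasure hK
      obtain ⟨C, μ', F, hF, hFψ, hF0, hC, hlim⟩ := exists_avoiding_modification (hψ r.1)
        (fun i => TopologicalSpace.isOpen_of_mem_countableBasis (r.2 i).2) hB μ.1
        μ.2.absolutelyContinuous
      obtain ⟨N, hN⟩ := μ.2.exists_of_tendsto hh hprec hZfin hC hlim
      exact ⟨⟨μ' N, hN⟩, F N, hF N, hF0 N, (Measure.absolutelyContinuous_of_le (hC N)).trans
        (Measure.AbsolutelyContinuous.rfl.smul_left C), fun _ => hFψ N⟩
    · exact ⟨μ, Set.univ, isClosed_univ, by simp, Measure.AbsolutelyContinuous.rfl,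
        fun h => absurd h hB⟩
  choose next G hGc hG0 hGac hGψ using hstep
  have : Nonempty (TopologicalSpace.countableBasis (EuclideanSpace ℝ (Fin d))) :=
    let ⟨B, _⟩ := exists_disjoint_mem_countableBasis (ι := Unit)
      (x := fun _ => (0 : EuclideanSpace ℝ (Fin d))) (Function.injective_of_subsingleton _)
    ⟨B ()⟩
  have : Nonempty R := ⟨⟨0, fun _ => Classical.arbitrary _⟩⟩
  have : Countable R := inferInstanceAs (Countable (Σ k, Fin (m k) → _))
  obtain ⟨req, hreq⟩ := exists_surjective_nat R
  let μ : ℕ → S := fun n => Nat.rec ⟨volume.restrict K, hJ⟩ (fun n μ => next (req n) μ) n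
  let F : ℕ → Set (EuclideanSpace ℝ (Fin d)) := fun n => G (req n) (μ n)
  have hac {n k : ℕ} (hnk : n ≤ k) : (μ k).1 ≪ (μ n).1 := by
    induction k, hnk using Nat.le_induction with
    | base => exact Measure.AbsolutelyContinuous.rfl
    | succ k _ ih => exact (hGac (req k) (μ k)).trans ih
  have hFclosed (n : ℕ) : IsClosed (F n) := hGc _ _
  refine ⟨K ∩ ⋂ n, F n, hK.inter_right (isClosed_iInter hFclosed), ?_, fun k x hxE hx => ?_⟩
  · refine lt_of_lt_of_le (ENNReal.half_pos hKpos) (le_hausdorffMeasureOf_inter_iInter hh hK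
      hFclosed (μ := fun n => (μ n).1) (fun n => (μ n).2.measure_compl hK.measurableSet)
      (fun n k hkn => hac (Nat.succ_le_of_lt hkn) (hG0 (req k) (μ k)))
      (fun n => (μ n).2.lt_univ.le) (dyadicScale_pos J)
      fun n U r hr hrJ hU => (μ n).2.measure_le hh hK.measurableSet hZ hr hrJ hU)
  · obtain ⟨B, hxB, hB⟩ := exists_disjoint_mem_countableBasis hx
    obtain ⟨n, hn⟩ := hreq ⟨k, B⟩
    have key := hGψ (req n) (μ n)
    have hF (i : Fin (m k)) : x i ∈ G (req n) (μ n) := Set.mem_iInter.1 (hxE i).2 n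
    generalize μ n = ρ at key hF
    rw [hn] at key hF
    exact key hB x fun i => ⟨hF i, hxB i⟩
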